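/- Theorem. Let $n_1,\dots,n_N$ be nonnegative integers, $n=n_1+\cdots+n_N$, and let $\mathcal X\subseteq\mathbb R^n=\prod_{i=1}^N\mathbb R^{n_i}$ be convex, compact and nonempty. Let $X_i\subseteq\mathbb R^{n_i}$ be the projection of $\mathcal X$ onto the $i$-th factor, let $X=\prod_{i=1}^N X_i$, and for $x\in X$ put $K_i(x)=\{z_i\in X_i : (x_{-i},z_i)\in\mathcal X\}$, where $(x_{-i},z_i)$ is $x$ with its $i$-th component replaced by $z_i$. For each player $i$ let $\succ_i$ be a binary relation on $X$ which is - irreflexive: $x\succ_i x$ for no $x\in X$; - convex: if $x,y,z\in X$, $x\succ_i z$ and $y\succ_i z$, then $tx+(1-t)y\succ_i z$ for all $t\in(0,1)$; - continuous: writing $x\succeq_i y$ when $y\succ_i x$ does not hold, if $(x_k)$ and $(y_k)$ are sequences in $X$ converging to $x\in X$ and $y\in X$, and $x_k\succeq_i y_k$ for all $k$, then $x\succeq_i y$. (No transitivity or completeness is assumed.) Then the jointly convex generalized Nash game $(\mathcal X,K_i,\succ_i)_{i=1}^N$ has an equilibrium: there is $\tilde x\in X$ such that, for every $i$, $\tilde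 x_i\in K_i(\tilde x)$ and there is no $y_i\in K_i(\tilde x)$ with $(\tilde x_{-i},y_i)\succ_i\tilde x$. -/

import Mathlib

open Set Filter Topology

namespace GNEP

/-- The space `ℝ^{n₁} × ⋯ × ℝ^{n_N}` of strategy profiles. -/
abbrev Profile {N : ℕ} (n : Fin N → ℕ) : Type :=
  (i : Fin N) → EuclideanSpace ℝ (Fin (n i))

section Sets

variable {N : ℕ} {n : Fin N → ℕ}

/-- The choice set `X_i` of player `i`: the projection of the joint constraint set `S`
onto `ℝ^{n_i}`. -/
def choiceSet (S : Set (Profile n)) (i : Fin N) : Set (EuclideanSpace ℝ (Fin (n i))) :=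
  (fun x : Profile n => x i) '' S

/-- The product `X = ∏ X_i` of a family of choice sets. -/
def profileSet (X : (i : Fin N) → Set (EuclideanSpace ℝ (Fin (n i)))) : Set (Profile n) :=
  {x | ∀ i, x i ∈ X i}

/-- The profile `(x_{-i}, z)`. -/
def replace (x : Profile n) (i : Fin N) (z : EuclideanSpace ℝ (Fin (n i))) : Profile n :=
  Function.update x i z

/-- The constraint map `K_i(x) = {z ∈ X_i | (x_{-i}, z) ∈ S}` of the jointly convex game. -/
def jointConstraint (S : Set (Profile n)) (i : Fin N) (x : Profile n) :
    Set (EuclideanSpace ℝ (Fin (n i))) :=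
  {z | z ∈ choiceSet S i ∧ replace x i z ∈ S}

/-- `x` is an equilibrium of the generalized Nash game `(X_i, K_i, ≻_i)`: it lies in `∏ X_i`,
each `x_i` is feasible, and no player has a feasible strategy that is strictly preferred. -/
def IsEquilibrium (X : (i : Fin N) → Set (EuclideanSpace ℝ (Fin (n i))))
    (K : (i : Fin N) → Profile n → Set (EuclideanSpace ℝ (Fin (n i))))
    (pref : Fin N → Profile n → Profile n → Prop) (x : Profile n) : Prop :=
  x ∈ profileSet X ∧
    ∀ i, x i ∈ K i x ∧ ¬ ∃ y ∈ K i x, pref i (replace x i y) x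

end Sets

section Relations

variable {E : Type*}

/-- `≻` is irreflexive over `X`. -/
def IrreflexiveOver (X : Set E) (pref : E → E → Prop) : Prop :=
  ∀ x ∈ X, ¬ pref x x

/-- `≻` is convex over `X`. -/
def ConvexOver [AddCommGroup E] [Module ℝ E] (X : Set E) (pref : E → E → Prop) : Prop :=
  ∀ x ∈ X, ∀ y ∈ X, ∀ z ∈ X, pref x z → pref y z →
    ∀ t : ℝ, 0 < t → t < 1 → pref (t • x + (1 - t) • y) z

/-- The weak relation `x ≽ y` induced by a strict relation `≻`: not `y ≻ x`. -/
def Weak (pref : E → E → Prop) (x y : E) : Prop := ¬ pref y x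

/-- `≻` is continuous over `X`: the induced weak relation passes to limits of sequences
(jointly in both arguments). In particular all upper and lower sections of `≻` are open
in `X`; see `ContinuousOver.isOpen_upper` and `ContinuousOver.isOpen_lower`. -/
def ContinuousOver [TopologicalSpace E] (X : Set E) (pref : E → E → Prop) : Prop :=
  ∀ (u v : ℕ → E) (x y : E), (∀ k, u k ∈ X) → (∀ k, v k ∈ X) → x ∈ X → y ∈ X →
    Tendsto u atTop (𝓝 x) → Tendsto v atTop (𝓝 y) →
    (∀ k, Weak pref (u k) (v k)) → Weak pref x y

theorem ContinuousOver.isOpen_upper [TopologicalSpace E] [FirstCountableTopology E]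
    {X : Set E} {pref : E → E → Prop} (h : ContinuousOver X pref) (y : X) :
    IsOpen {x : X | pref x y} := by
  rw [← isClosed_compl_iff]
  apply IsSeqClosed.isClosed
  intro u x hu hx
  exact h (fun _ => y) (fun k => u k) y x (fun _ => y.2) (fun k => (u k).2) y.2 x.2
    tendsto_const_nhds ((continuous_subtype_val.tendsto x).comp hx) (fun k => hu k)

theorem ContinuousOver.isOpen_lower [TopologicalSpace E] [FirstCountableTopology E]
    {X : Set E} {pref : E → E → Prop} (h : ContinuousOver X pref) (y : X) :
    IsOpen {x : X | pref y x} := by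
  rw [← isClosed_compl_iff]
  apply IsSeqClosed.isClosed
  intro u x hu hx
  exact h (fun k => u k) (fun _ => y) x y (fun k => (u k).2) (fun _ => y.2) x.2 y.2
    ((continuous_subtype_val.tendsto x).comp hx) tendsto_const_nhds (fun k => hu k)

end Relations

end GNEP

/-! Suppose no equilibrium exists. At `z ∈ S` consider profiles `p` of unit vectors, `p i` being
nonnegative on the strategies preferred to `z i`, measured from `z i` (`normals`). Such profiles
exist by separation, and over `z ∈ S` they form a compact graph. Let `T z` be the set of `w` whose
weighted pairing `∑ i, weight * ⟪p i, w i - z i⟫` is positive for every normal profile `p` at `z`.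
It is convex, and compactness of the graph makes its lower sections relatively open in `S`. If `T z`
meets `S` for all `z ∈ S`, Browder's theorem gives `z ∈ T z`, which is absurd because the pairing
vanishes at `w = z`.

To find a point of `S ∩ T z`, take a feasible improvement `y` of some player `i`. The point
`(z_{-i}, y)` lies in `S` and has nonnegative pairing. If the pairing is zero for some `p`, openness
of the preferred set makes `p i` nonnegative on all of `X_i - z i`; hence `⟪p i, x₀ i - z i⟫ ≥ r`
for a point `x₀ ∈ S` whose components all have relative interior radius `r`. The weights are
continuous, at least 1 on products `≥ r` and only `δ` on negative ones, so player `i` outweighs all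
others and the pairing with `x₀` is positive. By compactness, one small move from `(z_{-i}, y)`
towards `x₀` works for all `p` (`IsCompact.exists_combo_pos`).

Browder's theorem follows from a closed covering lemma on the simplex, obtained from Scarf's lemma
on finer and finer grids. -/

/-! ### Scarf's combinatorial lemma -/

section Scarf

variable {I P : Type*} [Fintype I] [DecidableEq I] [Fintype P] [DecidableEq P]

/-- A set `s` of points is dominating for the orders given by `v` if every point lies weakly
below all of `s` in one of the orders. -/
def IsDominating (v : I → P → ℕ) (s : Finset P) : Prop :=
  ∀ t, ∃ i, ∀ x ∈ s, v i t ≤ v i x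

omit [Fintype I] [DecidableEq I] [Fintype P] [DecidableEq P] in
theorem IsDominating.mono {v : I → P → ℕ} {s t : Finset P} (h : IsDominating v t) (hst : s ⊆ t) :
    IsDominating v s := fun p =>
  (h p).imp fun _ hi x hx => hi x (hst hx)

-- Each element of `τ` is the minimum of `τ` in some order. There is one more order than elements,
-- so exactly two orders `i`, `j` share a minimum. An added point must take over the role of one of
-- these two, and the best candidate for each role is unique.
open Classical in
theorem IsDominating.card_extensions {v : I → P → ℕ} (hv : ∀ i, Function.Injective (v i))
    {τ : Finset P} (hcard : τ.card + 1 = Fintype.card I) (hne : τ.Nonempty)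
    (hdom : IsDominating v τ)
    (hM : ∀ k, ∃ y, ∀ l, l ≠ k → ∃ s ∈ τ, v l s < v l y) :
    (Finset.univ.filter fun y => y ∉ τ ∧ IsDominating v (insert y τ)).card = 2 := by
  choose m hmτ hm using fun l => Finset.exists_min_image τ (v l) hne
  have hsurj : ∀ s ∈ τ, ∃ i, m i = s := fun s hs => by
    obtain ⟨i, hi⟩ := hdom s
    exact ⟨i, hv i (le_antisymm (hm i s hs) (hi _ (hmτ i)))⟩
  obtain ⟨i, -, j, -, hij, hmij⟩ := Finset.exists_ne_map_eq_of_card_lt_of_maps_to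
    (s := (Finset.univ : Finset I)) (t := τ) (f := m)
    (by rw [Finset.card_univ]; omega) (fun l _ => hmτ l)
  have hinj : ∀ k, (∀ s ∈ τ, ∃ l, l ≠ k ∧ m l = s) → ∀ a b, a ≠ k → b ≠ k → m a = m b → a = b := by
    intro k hk a b ha hb hab
    have himg : (Finset.univ.erase k).image m = τ := by
      ext s
      simp only [Finset.mem_image, Finset.mem_erase, Finset.mem_univ, and_true]
      exact ⟨fun ⟨l, _, hl⟩ => hl ▸ hmτ l, fun hs => hk s hs⟩
    have hc : ((Finset.univ.erase k).image m).card = (Finset.univ.erase k).card := by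
      rw [himg, Finset.card_erase_of_mem (Finset.mem_univ k), Finset.card_univ]; omega
    exact Finset.card_image_iff.1 hc (by simpa using ha) (by simpa using hb) hab
  -- The candidate for role `k` is the `v k`-largest among the points that leave the minima of all
  -- other orders unchanged.
  have hex : ∀ k, ∃ y, (∀ l, l ≠ k → v l (m l) < v l y) ∧
      ∀ t, (∀ l, l ≠ k → v l (m l) < v l t) → v k t ≤ v k y := by
    intro k
    obtain ⟨y, hy⟩ := hM k
    obtain ⟨z, hz, hzmax⟩ := Finset.exists_max_image
      (Finset.univ.filter fun t => ∀ l, l ≠ k → v l (m l) < v l t) (v k)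
      ⟨y, by
        simp only [Finset.mem_filter, Finset.mem_univ, true_and]
        intro l hl
        obtain ⟨s, hs, hsy⟩ := hy l hl
        exact (hm l s hs).trans_lt hsy⟩
    exact ⟨z, by simpa using hz, fun t ht => hzmax t (by simpa using ht)⟩
  choose Y hY hYmax using hex
  have hYdom : ∀ k, IsDominating v (insert (Y k) τ) := by
    intro k t
    by_cases ht : ∀ l, l ≠ k → v l (m l) < v l t
    · refine ⟨k, fun x hx => ?_⟩
      obtain ⟨l, hl⟩ := hdom (Y k)
      have hlk : l = k := by
        by_contra h
        exact absurd (hY k l h) (not_lt.2 (hl _ (hmτ l)))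
      subst hlk
      rcases Finset.mem_insert.1 hx with rfl | hx
      · exact hYmax _ t ht
      · exact (hYmax _ t ht).trans (hl x hx)
    · push Not at ht
      obtain ⟨l, hlk, hl⟩ := ht
      refine ⟨l, fun x hx => ?_⟩
      rcases Finset.mem_insert.1 hx with rfl | hx
      · exact hl.trans (hY k l hlk).le
      · exact hl.trans (hm l x hx)
  have hYnot : ∀ k, (∀ s ∈ τ, ∃ l, l ≠ k ∧ m l = s) → Y k ∉ τ := by
    intro k hk hmem
    obtain ⟨l, hl, h⟩ := hk _ hmem
    have := hY k l hl
    rw [h] at this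
    exact lt_irrefl _ this
  have hki : ∀ s ∈ τ, ∃ l, l ≠ i ∧ m l = s := by
    intro s hs
    obtain ⟨l, hl⟩ := hsurj s hs
    by_cases h : l = i
    · exact ⟨j, hij.symm, by rw [← hmij, ← h, hl]⟩
    · exact ⟨l, h, hl⟩
  have hkj : ∀ s ∈ τ, ∃ l, l ≠ j ∧ m l = s := by
    intro s hs
    obtain ⟨l, hl⟩ := hsurj s hs
    by_cases h : l = j
    · exact ⟨i, hij, by rw [hmij, ← h, hl]⟩
    · exact ⟨l, h, hl⟩
  have hYne : Y i ≠ Y j := by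
    intro h
    obtain ⟨l, hl⟩ := hdom (Y i)
    have h1 := hl _ (hmτ l)
    by_cases hli : l = i
    · have := hY j l (by rw [hli]; exact hij)
      rw [← h] at this
      omega
    · have := hY i l hli
      omega
  have : (Finset.univ.filter fun y => y ∉ τ ∧ IsDominating v (insert y τ)) = {Y i, Y j} := by
    ext y
    simp only [Finset.mem_filter, Finset.mem_univ, true_and, Finset.mem_insert,
      Finset.mem_singleton]
    constructor
    · rintro ⟨hyτ, hy⟩
      obtain ⟨k, hk⟩ := hy y
      have hl : ∀ s ∈ τ, ∃ l, l ≠ k ∧ m l = s ∧ v l s < v l y := by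
        intro s hs
        obtain ⟨l, hl⟩ := hy s
        have hsy : s ≠ y := fun h => hyτ (h ▸ hs)
        refine ⟨l, ?_, hv l (le_antisymm (hm l s hs) (hl _ (Finset.mem_insert_of_mem (hmτ l)))),
          lt_of_le_of_ne (hl y (Finset.mem_insert_self _ _)) fun h => hsy (hv l h)⟩
        rintro rfl
        exact hsy (hv l (le_antisymm (hl y (Finset.mem_insert_self _ _))
          (hk s (Finset.mem_insert_of_mem hs))))
      have hinjk := hinj k fun s hs => (hl s hs).imp fun _ h => ⟨h.1, h.2.1⟩
      have hyM : ∀ l, l ≠ k → v l (m l) < v l y := by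
        intro l hlk
        obtain ⟨l', hl', h1, h2⟩ := hl (m l) (hmτ l)
        rwa [hinjk l' l hl' hlk h1] at h2
      have hyY : y = Y k := by
        refine hv k (le_antisymm (hYmax k y hyM) ?_)
        obtain ⟨l, hl⟩ := hy (Y k)
        have hlk : l = k := by
          by_contra h
          exact absurd (hY k l h) (not_lt.2 (hl _ (Finset.mem_insert_of_mem (hmτ l))))
        subst hlk
        exact hl y (Finset.mem_insert_self _ _)
      by_cases hik : i = k
      · left; rw [hyY, hik]
      · by_cases hjk : j = k
        · right; rw [hyY, hjk]
        · exact absurd (hinjk i j hik hjk hmij) hij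
    · rintro (rfl | rfl)
      · exact ⟨hYnot i hki, hYdom i⟩
      · exact ⟨hYnot j hkj, hYdom j⟩
  rw [this, Finset.card_pair hYne]

-- The bottom elements `e i`, `i ≠ k`, make every order but `k` useless for dominating a point
-- outside them, so the added point must be the `v k`-maximum outside.
open Classical in
theorem card_extensions_slack {v : I → P → ℕ} (hv : ∀ i, Function.Injective (v i))
    {e : I → P} (he : Function.Injective e) (hbot : ∀ i p, v i (e i) ≤ v i p)
    (htop : ∀ i j, j ≠ i → ∀ p ∉ Set.range e, v i p < v i (e j)) (k : I) :
    (Finset.univ.filter fun y => y ∉ (Finset.univ.erase k).image e ∧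
      IsDominating v (insert y ((Finset.univ.erase k).image e))).card = 1 := by
  set τ := (Finset.univ.erase k).image e with hτ
  have hmem : ∀ i, i ≠ k → e i ∈ τ := fun i hi =>
    Finset.mem_image_of_mem _ (Finset.mem_erase.2 ⟨hi, Finset.mem_univ _⟩)
  have hek : e k ∉ τ := by
    simp [hτ, he.eq_iff]
  obtain ⟨y, hy, hymax⟩ := Finset.exists_max_image (Finset.univ.filter fun t => t ∉ τ) (v k)
    ⟨e k, by simpa using hek⟩
  rw [Finset.card_eq_one]
  refine ⟨y, ?_⟩
  ext z
  simp only [Finset.mem_filter, Finset.mem_univ, true_and, Finset.mem_singleton] at hy hymax ⊢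
  constructor
  · rintro ⟨hz, hdom⟩
    obtain ⟨i, hi⟩ := hdom y
    have hik : i = k := by
      by_contra hik
      have := hi (e i) (Finset.mem_insert_of_mem (hmem i hik))
      exact hy (hv i (le_antisymm this (hbot i y)) ▸ hmem i hik)
    subst hik
    exact hv i (le_antisymm (hymax z hz) (hi z (Finset.mem_insert_self _ _)))
  · rintro rfl
    refine ⟨hy, fun t => ?_⟩
    by_cases ht : t ∈ τ
    · obtain ⟨i, -, rfl⟩ := Finset.mem_image.1 ht
      exact ⟨i, fun x _ => hbot i x⟩
    · refine ⟨k, fun x hx => ?_⟩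
      rcases Finset.mem_insert.1 hx with rfl | hx
      · exact hymax t ht
      · obtain ⟨j, hj, rfl⟩ := Finset.mem_image.1 hx
        by_cases hte : t ∈ Set.range e
        · obtain ⟨i, rfl⟩ := hte
          have : i = k := by
            by_contra h
            exact ht (hmem i h)
          subst this
          exact hbot i _
        · exact (htop k j (Finset.mem_erase.1 hj).1 t hte).le

-- If removing `x` leaves exactly the colours other than `i₀`, the colour of `x` is repeated at
-- exactly one other point `x'`; only the removals of `x` and `x'` qualify.
open Classical in
omit [Fintype P] in
theorem even_card_facets {c : P → I} {i₀ : I} {σ : Finset P} (hσ : σ.card = Fintype.card I)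
    (hc : σ.image c ≠ Finset.univ) :
    Even (σ.filter fun x => (σ.erase x).image c = Finset.univ.erase i₀).card := by
  rcases (σ.filter fun x => (σ.erase x).image c = Finset.univ.erase i₀).eq_empty_or_nonempty
    with h | ⟨x, hx⟩
  · simp [h]
  obtain ⟨hxσ, hx⟩ := Finset.mem_filter.1 hx
  have hpos : 0 < Fintype.card I := Fintype.card_pos_iff.2 ⟨i₀⟩
  have hinj : Set.InjOn c (σ.erase x) := by
    apply Finset.card_image_iff.1
    rw [hx, Finset.card_erase_of_mem (Finset.mem_univ _), Finset.card_erase_of_mem hxσ, hσ,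
      Finset.card_univ]
  have hcx : c x ≠ i₀ := by
    rintro rfl
    apply hc
    rw [← Finset.insert_erase hxσ, Finset.image_insert, hx,
      Finset.insert_erase (Finset.mem_univ _)]
  have hcx' : c x ∈ (σ.erase x).image c := by simp [hx, hcx]
  obtain ⟨x', hx'σ, hx'c⟩ := Finset.mem_image.1 hcx'
  obtain ⟨hx'x, hx'σ'⟩ := Finset.mem_erase.1 hx'σ
  have : (σ.filter fun y => (σ.erase y).image c = Finset.univ.erase i₀) = {x, x'} := by
    ext y
    simp only [Finset.mem_filter, Finset.mem_insert, Finset.mem_singleton]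
    constructor
    · rintro ⟨hyσ, hy⟩
      by_contra! hne
      have hcy : c y ∈ (σ.erase y).image c := by
        rw [hy, ← hx]
        exact Finset.mem_image_of_mem _ (Finset.mem_erase.2 ⟨hne.1, hyσ⟩)
      obtain ⟨z, hz, hzy⟩ := Finset.mem_image.1 hcy
      obtain ⟨hzy', hzσ⟩ := Finset.mem_erase.1 hz
      by_cases hzx : z = x
      · subst hzx
        exact hne.2 (hinj (by simp [hyσ, hne.1]) (by simp [hx'x, hx'σ']) (by rw [hx'c, hzy]))
      · exact hzy' (hinj (by simp [hzσ, hzx]) (by simp [hyσ, hne.1]) hzy)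
    · rintro (rfl | rfl)
      · exact ⟨hxσ, hx⟩
      · refine ⟨hx'σ', ?_⟩
        rw [← hx]
        have h1 : σ.erase y = insert x ((σ.erase x).erase y) := by
          rw [Finset.erase_right_comm, Finset.insert_erase]
          exact Finset.mem_erase.2 ⟨hx'x.symm, hxσ⟩
        rw [h1, Finset.image_insert, ← hx'c, ← Finset.image_insert, Finset.insert_erase hx'σ]
  rw [this, Finset.card_pair hx'x.symm]
  exact even_two

open Classical in
/-- **Scarf's lemma**: a colouring of the points with slack vectors has a rainbow dominating
set. -/
theorem exists_rainbow_dominating [Nonempty I] {v : I → P → ℕ}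
    (hv : ∀ i, Function.Injective (v i)) {e : I → P} (hbot : ∀ i p, v i (e i) ≤ v i p)
    (htop : ∀ i j, j ≠ i → ∀ p ∉ Set.range e, v i p < v i (e j))
    {c : P → I} (hc : ∀ i, c (e i) = i) :
    ∃ σ : Finset P, σ.card = Fintype.card I ∧ IsDominating v σ ∧ σ.image c = Finset.univ := by
  have he : Function.Injective e := Function.LeftInverse.injective hc
  by_contra! hno
  obtain ⟨i₀⟩ := ‹Nonempty I›
  set R : Finset (Finset P) :=
    Finset.univ.filter fun σ => σ.card = Fintype.card I ∧ IsDominating v σ with hR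
  set D : Finset (Finset P) := Finset.univ.filter fun τ =>
    (τ.card + 1 = Fintype.card I ∧ IsDominating v τ) ∧ τ.image c = Finset.univ.erase i₀ with hD
  -- Incidences are counted twice: without a rainbow set each `σ` contributes an even number, while
  -- every `τ` contributes 2 except the all-slack `τ₀`, which contributes 1.
  have hcount := Finset.sum_card_bipartiteAbove_eq_sum_card_bipartiteBelow
    (s := R) (t := D) (fun σ τ => τ ⊆ σ)
  have hpos : 0 < Fintype.card I := Fintype.card_pos_iff.2 ⟨i₀⟩
  have heven : Even (∑ σ ∈ R, (D.bipartiteAbove (fun σ τ => τ ⊆ σ) σ).card) := by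
    refine Finset.even_sum _ fun σ hσ => ?_
    obtain ⟨hσc, hσd⟩ := (Finset.mem_filter.1 hσ).2
    have : D.bipartiteAbove (fun σ τ => τ ⊆ σ) σ =
        (σ.filter fun x => (σ.erase x).image c = Finset.univ.erase i₀).image (σ.erase ·) := by
      ext τ
      simp only [Finset.bipartiteAbove, hD, Finset.mem_filter, Finset.mem_univ, true_and,
        Finset.mem_image]
      constructor
      · rintro ⟨⟨⟨h1, h2⟩, h3⟩, h4⟩
        obtain ⟨x, hx, rfl⟩ := (Finset.covBy_iff_exists_erase).1
          (Finset.covBy_iff_card_sdiff_eq_one.2 ⟨h4, by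
            rw [Finset.card_sdiff_of_subset h4]; omega⟩)
        exact ⟨x, ⟨hx, h3⟩, rfl⟩
      · rintro ⟨x, ⟨hx, h3⟩, rfl⟩
        refine ⟨⟨⟨?_, hσd.mono (Finset.erase_subset _ _)⟩, h3⟩, Finset.erase_subset _ _⟩
        rw [Finset.card_erase_of_mem hx]; omega
    rw [this, Finset.card_image_of_injOn]
    · exact even_card_facets hσc (hno σ hσc hσd)
    · intro x hx y hy hxy
      exact (Finset.erase_inj σ (Finset.mem_filter.1 hx).1).1 hxy
  have hbelow : ∀ τ ∈ D, (R.bipartiteBelow (fun σ τ => τ ⊆ σ) τ).card =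
      (Finset.univ.filter fun y => y ∉ τ ∧ IsDominating v (insert y τ)).card := by
    intro τ hτ
    obtain ⟨⟨h1, h2⟩, h3⟩ := (Finset.mem_filter.1 hτ).2
    have : R.bipartiteBelow (fun σ τ => τ ⊆ σ) τ =
        (Finset.univ.filter fun y => y ∉ τ ∧ IsDominating v (insert y τ)).image
          (insert · τ) := by
      ext σ
      simp only [Finset.bipartiteBelow, hR, Finset.mem_filter, Finset.mem_univ, true_and,
        Finset.mem_image]
      constructor
      · rintro ⟨⟨h4, h5⟩, h6⟩
        obtain ⟨y, hy, rfl⟩ := (Finset.covBy_iff_exists_insert).1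
          (Finset.covBy_iff_card_sdiff_eq_one.2 ⟨h6, by
            rw [Finset.card_sdiff_of_subset h6]; omega⟩)
        exact ⟨y, ⟨hy, h5⟩, rfl⟩
      · rintro ⟨y, ⟨hy, h5⟩, rfl⟩
        exact ⟨⟨by rw [Finset.card_insert_of_notMem hy, h1], h5⟩, Finset.subset_insert _ _⟩
    rw [this, Finset.card_image_of_injOn]
    intro x hx y hy hxy
    exact (Finset.insert_inj (by simpa using (Finset.mem_filter.1 hx).2.1)).1 hxy
  set τ₀ := (Finset.univ.erase i₀).image e with hτ₀
  have hτ₀D : τ₀ ∈ D := by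
    refine Finset.mem_filter.2 ⟨Finset.mem_univ _, ⟨?_, ?_⟩, ?_⟩
    · rw [Finset.card_image_of_injective _ he, Finset.card_erase_of_mem (Finset.mem_univ _),
        Finset.card_univ]
      omega
    · obtain ⟨y, hy⟩ := Finset.card_pos.1
        (by rw [card_extensions_slack hv he hbot htop i₀]; exact one_pos)
      exact (Finset.mem_filter.1 hy).2.2.mono (Finset.subset_insert _ _)
    · rw [hτ₀, Finset.image_image]
      ext i
      simp [hc]
  have hodd : Odd (∑ τ ∈ D, (R.bipartiteBelow (fun σ τ => τ ⊆ σ) τ).card) := by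
    rw [← Finset.add_sum_erase _ _ hτ₀D, hbelow _ hτ₀D, card_extensions_slack hv he hbot htop i₀,
      add_comm]
    refine Even.add_one (Finset.even_sum _ fun τ hτ => ?_)
    obtain ⟨hττ₀, hτ⟩ := Finset.mem_erase.1 hτ
    rw [hbelow τ hτ]
    obtain ⟨⟨h1, h2⟩, h3⟩ := (Finset.mem_filter.1 hτ).2
    have hreal : ∃ p ∈ τ, p ∉ Set.range e := by
      by_contra! hall
      refine hττ₀ (Finset.eq_of_subset_of_card_le (fun p hp => ?_) ?_)
      · obtain ⟨i, rfl⟩ := hall p hp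
        have : c (e i) ∈ τ.image c := Finset.mem_image_of_mem _ hp
        rw [h3, hc] at this
        exact Finset.mem_image_of_mem _ this
      · have := (Finset.mem_filter.1 hτ₀D).2.1.1
        omega
    obtain ⟨p, hpτ, hp⟩ := hreal
    rw [IsDominating.card_extensions hv h1 ⟨p, hpτ⟩ h2 fun k =>
      ⟨e k, fun l hl => ⟨p, hpτ, htop l k hl.symm p hp⟩⟩]
    exact even_two
  rw [← hcount] at hodd
  exact (Nat.not_even_iff_odd.2 hodd) heven

end Scarf

/-! ### A covering lemma on the simplex -/

section Simplex

variable {ι : Type*} [Fintype ι] [Nonempty ι]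

omit [Nonempty ι] in
theorem exists_sum_eq_of_le {C : Finset ι} (hC : C.Nonempty) {K : ℕ} (f : ι → ℕ)
    (h : ∑ i ∈ C, f i ≤ K) : ∃ t : ι → ℕ, ∑ i, t i = K ∧ ∀ i ∈ C, f i ≤ t i := by
  classical
  obtain ⟨j, hj⟩ := hC
  refine ⟨fun i => (if i ∈ C then f i else 0) + if i = j then K - ∑ i ∈ C, f i else 0, ?_, ?_⟩
  · rw [Finset.sum_add_distrib]
    simp
    omega
  · intro i hi
    simp [hi]

/-- Any colouring of the grid points of mesh `1 / K` of the simplex has a nearly rainbow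
cluster around some grid point: each colour is found close by, unless the corresponding
coordinate is small. -/
theorem exists_grid_cluster (K : ℕ) (c : (ι → ℕ) → ι) :
    ∃ t₀ : ι → ℕ, ∑ i, t₀ i = K ∧ ∀ i, t₀ i ≤ Fintype.card ι ∨
      ∃ t : ι → ℕ, ∑ i, t i = K ∧ c t = i ∧
        ∀ j, t j ≤ t₀ j + Fintype.card ι ∧ t₀ j ≤ t j + Fintype.card ι := by
  classical
  let G := ↥(Finset.piAntidiag Finset.univ K : Finset (ι → ℕ))
  have hG : ∀ t : G, ∑ i, t.1 i = K := fun t => (Finset.mem_piAntidiag.1 t.2).1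
  set M := Fintype.card G with hM
  let eG := Fintype.equivFin G
  let eI := Fintype.equivFin ι
  -- Order `i` compares `i`-th coordinates, with ties broken by `eG t < M`. The slack `i` takes the
  -- reserved value 0, and the other slacks lie above all grid points.
  let v : ι → G ⊕ ι → ℕ := fun i => Sum.elim (fun t => 1 + M * t.1 i + eG t)
    (fun j => if j = i then 0 else M * K + M + 1 + eI j)
  have hle : ∀ (t : G) i, t.1 i ≤ K := fun t i =>
    (Finset.single_le_sum (f := t.1) (fun _ _ => Nat.zero_le _) (Finset.mem_univ i)).trans_eq
      (hG t)
  have hvlt : ∀ i (s t : G), s.1 i < t.1 i → v i (.inl s) < v i (.inl t) := by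
    intro i s t h
    have h1 : M * s.1 i + M ≤ M * t.1 i := by
      rw [← Nat.mul_succ]; exact Nat.mul_le_mul_left _ h
    have h2 : (eG s : ℕ) < M := (eG s).2
    simp only [v, Sum.elim_inl]
    omega
  have hvtop : ∀ i j, j ≠ i → ∀ t : G, v i (.inl t) < v i (.inr j) := by
    intro i j h t
    have h1 : M * t.1 i ≤ M * K := Nat.mul_le_mul_left _ (hle t i)
    have h2 : (eG t : ℕ) < M := (eG t).2
    simp only [v, Sum.elim_inl, Sum.elim_inr, h, if_false]
    omega
  have hvself : ∀ i, v i (.inr i) = 0 := fun i => by simp [v]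
  have hvpos : ∀ i t, 0 < v i (.inl t) := fun i t => by simp only [v, Sum.elim_inl]; omega
  have hvpos' : ∀ i j, j ≠ i → 0 < v i (.inr j) := fun i j h => by simp [v, h]
  have hv : ∀ i, Function.Injective (v i) := by
    rintro i (s | j) (t | k) h
    · rcases lt_trichotomy (s.1 i) (t.1 i) with h' | h' | h'
      · exact absurd h (hvlt i s t h').ne
      · have : (eG s : ℕ) = eG t := by
          simp only [v, Sum.elim_inl, h'] at h
          omega
        rw [eG.injective (Fin.ext this)]
      · exact absurd h (hvlt i t s h').ne'
    · by_cases hk : k = i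
      · subst hk; exact absurd (h.trans (hvself k)) (hvpos k s).ne'
      · exact absurd h (hvtop i k hk s).ne
    · by_cases hk : j = i
      · subst hk; exact absurd (h.symm.trans (hvself j)) (hvpos j t).ne'
      · exact absurd h (hvtop i j hk t).ne'
    · by_cases hj : j = i
      · by_cases hk : k = i
        · rw [hj, hk]
        · subst hj
          exact absurd (h.symm.trans (hvself j)) (hvpos' j k hk).ne'
      · by_cases hk : k = i
        · subst hk
          exact absurd (h.trans (hvself k)) (hvpos' k j hj).ne'
        · have : (eI j : ℕ) = eI k := by
            simp only [v, Sum.elim_inr, hj, hk, if_false] at h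
            omega
          rw [eI.injective (Fin.ext this)]
  obtain ⟨σ, hσc, hσd, hσ⟩ := exists_rainbow_dominating hv (e := Sum.inr)
    (fun i p => by rw [hvself]; exact Nat.zero_le _)
    (by
      rintro i j h (t | k) hp
      · exact hvtop i j h t
      · exact absurd ⟨k, rfl⟩ hp)
    (c := Sum.elim (fun t => c t.1) id) (fun i => rfl)
  have hdom : ∀ t : G, ∃ i, Sum.inr i ∉ σ ∧ ∀ s : G, Sum.inl s ∈ σ → t.1 i ≤ s.1 i := by
    intro t
    obtain ⟨i, hi⟩ := hσd (.inl t)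
    refine ⟨i, fun hiσ => ?_, fun s hs => ?_⟩
    · have := hi _ hiσ
      rw [hvself] at this
      exact absurd this (not_le.2 (hvpos i t))
    · by_contra h
      exact absurd (hi _ hs) (not_le.2 (hvlt i s t (not_le.1 h)))
  have hcol : ∀ i, Sum.inr i ∉ σ → ∃ t : G, Sum.inl t ∈ σ ∧ c t.1 = i := by
    intro i hi
    obtain ⟨p, hp, hpi⟩ := Finset.mem_image.1 (hσ.symm ▸ Finset.mem_univ i : i ∈ σ.image _)
    rcases p with t | j
    · exact ⟨t, hp, hpi⟩
    · simp only [Sum.elim_inr, id] at hpi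
      exact absurd (hpi ▸ hp) hi
  set C : Finset ι := Finset.univ.filter fun i => Sum.inr i ∉ σ with hC
  have hmemC : ∀ i, i ∈ C ↔ Sum.inr i ∉ σ := by simp [hC]
  obtain ⟨t₁, ht₁, -⟩ := exists_sum_eq_of_le (K := K) (Finset.univ_nonempty (α := ι)) 0 (by simp)
  obtain ⟨i₁, hi₁, -⟩ := hdom ⟨t₁, Finset.mem_piAntidiag.2 ⟨ht₁, by simp⟩⟩
  have hCne : C.Nonempty := ⟨i₁, (hmemC _).2 hi₁⟩
  obtain ⟨t₀, ht₀, -⟩ := hcol i₁ hi₁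
  have hmin : ∀ i, ∃ s : G, Sum.inl s ∈ σ ∧ ∀ t : G, Sum.inl t ∈ σ → s.1 i ≤ t.1 i := by
    intro i
    obtain ⟨s, hs, hmin⟩ := Finset.exists_min_image
      (Finset.univ.filter fun s : G => Sum.inl s ∈ σ) (fun s => s.1 i) ⟨t₀, by simpa using ht₀⟩
    exact ⟨s, by simpa using hs, fun t ht => hmin t (by simpa using ht)⟩
  choose m hmσ hm using hmin
  -- Otherwise some grid point exceeds the minimum of `σ` in every coordinate of `C`, so it is not
  -- dominated. Hence the coordinates of any grid point of `σ` exceed the minima over `C` by fewer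
  -- than `C.card` in total.
  have hsum : K < ∑ i ∈ C, ((m i).1 i + 1) := by
    by_contra! h
    obtain ⟨t, ht, htC⟩ := exists_sum_eq_of_le hCne (fun i => (m i).1 i + 1) h
    obtain ⟨i, hi, hle⟩ := hdom ⟨t, Finset.mem_piAntidiag.2 ⟨ht, by simp⟩⟩
    have h1 := htC i ((hmemC i).2 hi)
    have h2 := hle (m i) (hmσ i)
    simp only at h1 h2
    omega
  rw [Finset.sum_add_distrib, Finset.sum_const, smul_eq_mul, mul_one] at hsum
  have hCcard : C.card ≤ Fintype.card ι := Finset.card_le_univ C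
  have hub : ∀ t : G, Sum.inl t ∈ σ → ∀ i,
      (i ∈ C → t.1 i ≤ (m i).1 i + Fintype.card ι) ∧ (i ∉ C → t.1 i ≤ Fintype.card ι) := by
    intro t ht i
    have hK := hG t
    rw [← Finset.sum_add_sum_compl C] at hK
    constructor
    · intro hi
      rw [← Finset.add_sum_erase _ _ hi] at hK hsum
      have : ∑ j ∈ C.erase i, (m j).1 j ≤ ∑ j ∈ C.erase i, t.1 j :=
        Finset.sum_le_sum fun j _ => hm j t ht
      omega
    · intro hi
      have h1 : ∑ j ∈ C, (m j).1 j ≤ ∑ j ∈ C, t.1 j := Finset.sum_le_sum fun j _ => hm j t ht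
      have h2 : t.1 i ≤ ∑ j ∈ Cᶜ, t.1 j :=
        Finset.single_le_sum (f := t.1) (fun _ _ => Nat.zero_le _) (Finset.mem_compl.2 hi)
      omega
  refine ⟨t₀.1, hG t₀, fun i => ?_⟩
  by_cases hi : i ∈ C
  · right
    obtain ⟨t, ht, htc⟩ := hcol i ((hmemC i).1 hi)
    refine ⟨t.1, hG t, htc, fun j => ?_⟩
    by_cases hj : j ∈ C
    · have h1 := (hub t ht j).1 hj
      have h2 := (hub t₀ ht₀ j).1 hj
      have h3 := hm j t ht
      have h4 := hm j t₀ ht₀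
      omega
    · have h1 := (hub t ht j).2 hj
      have h2 := (hub t₀ ht₀ j).2 hj
      omega
  · exact Or.inl ((hub t₀ ht₀ i).2 hi)

/-- Closed sets which cover the simplex, the `l`-th of which contains the `l`-th facet, have a
common point. -/
theorem exists_mem_forall_of_stdSimplex_subset_iUnion {F : ι → Set (ι → ℝ)}
    (hF : ∀ l, IsClosed (F l)) (hcov : stdSimplex ℝ ι ⊆ ⋃ l, F l)
    (hfacet : ∀ l, ∀ t ∈ stdSimplex ℝ ι, t l = 0 → t ∈ F l) :
    ∃ t ∈ stdSimplex ℝ ι, ∀ l, t ∈ F l := by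
  classical
  let q : ℕ → (ι → ℕ) → ι → ℝ := fun K t i => (t i : ℝ) / (K + 1)
  have hq : ∀ K t, ∑ i, t i = K + 1 → q K t ∈ stdSimplex ℝ ι := by
    intro K t ht
    refine ⟨fun i => by positivity, ?_⟩
    rw [← Finset.sum_div, ← Nat.cast_sum, ht]
    push_cast
    exact div_self (by positivity)
  have hcol : ∀ K : ℕ, ∃ c : (ι → ℕ) → ι, ∀ t, ∑ i, t i = K + 1 → q K t ∈ F (c t) := by
    intro K
    refine ⟨fun t => if h : ∃ l, q K t ∈ F l then h.choose else Classical.arbitrary ι,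
      fun t ht => ?_⟩
    have h : ∃ l, q K t ∈ F l := mem_iUnion.1 (hcov (hq K t ht))
    simpa [h] using h.choose_spec
  choose c hc using hcol
  choose t₀ ht₀ hcl using fun K => exists_grid_cluster (K + 1) (c K)
  obtain ⟨t, ht, φ, hφ, hlim⟩ := (isCompact_stdSimplex ℝ ι).tendsto_subseq
    (fun K => hq K (t₀ K) (ht₀ K))
  refine ⟨t, ht, fun l => ?_⟩
  by_contra hl
  have htl : 0 < t l := lt_of_le_of_ne (ht.1 l) fun h => hl (hfacet l t ht h.symm)
  obtain ⟨ε, hε, hball⟩ := Metric.mem_nhds_iff.1 ((hF l).isOpen_compl.mem_nhds hl)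
  have hsmall : Tendsto (fun K : ℕ => (Fintype.card ι : ℝ) / ((φ K : ℝ) + 1)) atTop (𝓝 0) := by
    apply Tendsto.div_atTop tendsto_const_nhds
    exact tendsto_atTop_add_const_right _ _ (tendsto_natCast_atTop_atTop.comp hφ.tendsto_atTop)
  have hliml : Tendsto (fun K => q (φ K) (t₀ (φ K)) l) atTop (𝓝 (t l)) :=
    (tendsto_pi_nhds.1 hlim) l
  obtain ⟨K, h1, h2, h3, h4⟩ := ((hsmall.eventually (gt_mem_nhds (half_pos hε))).and
    ((hlim.eventually (Metric.ball_mem_nhds t (half_pos hε))).and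
    ((hsmall.eventually (gt_mem_nhds (half_pos htl))).and
    (hliml.eventually (lt_mem_nhds (half_lt_self htl)))))).exists
  have hpos : (0 : ℝ) < (φ K : ℝ) + 1 := by positivity
  rcases hcl (φ K) l with h | ⟨s, hs, hsl, hclose⟩
  · have : q (φ K) (t₀ (φ K)) l ≤ (Fintype.card ι : ℝ) / ((φ K : ℝ) + 1) := by
      simp only [q]; gcongr
    linarith
  · have hsF := hc (φ K) s hs
    rw [hsl] at hsF
    refine hball ?_ hsF
    rw [Metric.mem_ball]
    have hd : dist (q (φ K) s) (q (φ K) (t₀ (φ K))) ≤ (Fintype.card ι : ℝ) / ((φ K : ℝ) + 1) := by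
      refine (dist_pi_le_iff (by positivity)).2 fun j => ?_
      obtain ⟨ha, hb⟩ := hclose j
      have ha' : (s j : ℝ) ≤ t₀ (φ K) j + Fintype.card ι := by exact_mod_cast ha
      have hb' : (t₀ (φ K) j : ℝ) ≤ s j + Fintype.card ι := by exact_mod_cast hb
      simp only [q]
      rw [Real.dist_eq, ← sub_div, abs_div, abs_of_pos hpos]
      gcongr
      rw [abs_le]
      constructor <;> linarith
    have h2' : dist (q (φ K) (t₀ (φ K))) t < ε / 2 := h2
    linarith [dist_triangle (q (φ K) s) (q (φ K) (t₀ (φ K))) t]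

end Simplex

/-- **Browder's fixed point theorem** for a set-valued map with convex values and open lower
sections on a compact convex set. -/
theorem exists_mem_self_of_isClosed_lower {E : Type*} [AddCommGroup E] [Module ℝ E]
    [TopologicalSpace E] [IsTopologicalAddGroup E] [ContinuousSMul ℝ E] {S : Set E}
    (hS : Convex ℝ S) (hcomp : IsCompact S) (hne : S.Nonempty) {T : E → Set E}
    (hconv : ∀ z ∈ S, Convex ℝ (T z)) (hT : ∀ z ∈ S, (S ∩ T z).Nonempty)
    (hclosed : ∀ w ∈ S, IsClosed {z | z ∈ S ∧ w ∉ T z}) : ∃ z ∈ S, z ∈ T z := by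
  classical
  obtain ⟨J, hJ⟩ := hcomp.elim_finite_subcover (fun w : S => {z | z ∈ S ∧ w.1 ∉ T z}ᶜ)
    (fun w => (hclosed w w.2).isOpen_compl) fun z hz => by
      obtain ⟨w, hw, hwz⟩ := hT z hz
      exact mem_iUnion.2 ⟨⟨w, hw⟩, fun h => h.2 hwz⟩
  have hO : ∀ z ∈ S, ∀ w : S, z ∈ {z | z ∈ S ∧ w.1 ∉ T z}ᶜ → w.1 ∈ T z := fun z hz w h => by
    by_contra hw
    exact h ⟨hz, hw⟩
  have hJne : Nonempty J := by
    obtain ⟨z, hz⟩ := hne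
    obtain ⟨w, hw, -⟩ := mem_iUnion₂.1 (hJ hz)
    exact ⟨⟨w, hw⟩⟩
  let ψ : (J → ℝ) → E := fun t => ∑ l, t l • (l.1.1 : E)
  have hψ : Continuous ψ := by fun_prop
  have hψS : ∀ t ∈ stdSimplex ℝ J, ψ t ∈ S := fun t ht =>
    hS.sum_mem (fun l _ => ht.1 l) ht.2 fun l _ => l.1.2
  -- The open cover is shrunk to a closed one. Adding the facets `t l = 0` then costs nothing, since
  -- a vertex of zero weight does not enter `ψ t`.
  obtain ⟨D, hDcov, hDclosed, hDO⟩ := exists_subset_iUnion_closed_subset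
    (isClosed_stdSimplex ℝ J)
    (u := fun l : J => ψ ⁻¹' {z | z ∈ S ∧ l.1.1 ∉ T z}ᶜ)
    (fun l => (hclosed l.1 l.1.2).isOpen_compl.preimage hψ) (fun _ _ => Set.toFinite _)
    (fun t ht => by
      obtain ⟨w, hw, hwt⟩ := mem_iUnion₂.1 (hJ (hψS t ht))
      exact mem_iUnion.2 ⟨⟨w, hw⟩, hwt⟩)
  obtain ⟨t, ht, hmem⟩ := exists_mem_forall_of_stdSimplex_subset_iUnion
    (F := fun l => D l ∪ {t | t l = 0})
    (fun l => (hDclosed l).union (isClosed_eq (continuous_apply l) continuous_const))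
    (hDcov.trans (iUnion_mono fun l => subset_union_left)) (fun l t _ h => Or.inr h)
  refine ⟨ψ t, hψS t ht, ?_⟩
  have hsum : ∑ l ∈ Finset.univ.filter fun l => t l ≠ 0, t l • (l.1.1 : E) = ψ t :=
    Finset.sum_filter_of_ne fun l _ h h0 => h (by rw [h0, zero_smul])
  rw [← hsum]
  refine (hconv (ψ t) (hψS t ht) |> (hsum ▸ ·) : Convex ℝ (T _)).sum_mem (fun l _ => ht.1 l) ?_ ?_
  · rw [Finset.sum_filter_ne_zero]; exact ht.2
  · intro l hl
    rw [hsum]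
    refine hO _ (hψS t ht) l.1 (hDO l ?_)
    exact (hmem l).resolve_right (Finset.mem_filter.1 hl).2

/-! ### Supporting vectors of convex sets in finite dimension -/

section Support

open scoped RealInnerProductSpace

variable {E : Type*} [NormedAddCommGroup E] [InnerProductSpace ℝ E]

/-- By compactness of the unit sphere of `V` it suffices to treat finitely many points of `A`, where
the nearest point to 0 of their hull gives the direction. No closedness of `A` is needed. -/
theorem Convex.exists_norm_eq_one_forall_inner_nonneg [FiniteDimensional ℝ E] {V : Submodule ℝ E}
    (hV : V ≠ ⊥) {A : Set E} (hA : Convex ℝ A) (hAV : A ⊆ V) (h0 : (0 : E) ∉ A) :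
    ∃ p ∈ V, ‖p‖ = 1 ∧ ∀ a ∈ A, 0 ≤ ⟪p, a⟫ := by
  have hcomp : IsCompact (Metric.sphere (0 : E) 1 ∩ V) :=
    (isCompact_sphere 0 1).inter_right V.closed_of_finiteDimensional
  have hunit : ∀ v ∈ V, v ≠ 0 → ‖v‖⁻¹ • v ∈ Metric.sphere (0 : E) 1 ∩ V := fun v hv hne =>
    ⟨by simp [norm_smul, hne], V.smul_mem _ hv⟩
  obtain ⟨p, ⟨hp1, hpV⟩, hp⟩ := hcomp.inter_iInter_nonempty (fun a : A => {p : E | 0 ≤ ⟪p, a.1⟫})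
    (fun a => isClosed_le continuous_const (by fun_prop)) fun u => by
      rcases u.eq_empty_or_nonempty with rfl | hu
      · obtain ⟨v, hv, hne⟩ := V.ne_bot_iff.1 hV
        exact ⟨_, hunit v hv hne, by simp⟩
      · let C := convexHull ℝ ((fun a : A => a.1) '' u)
        have hCA : C ⊆ A := convexHull_min (by rintro _ ⟨a, _, rfl⟩; exact a.2) hA
        have hCc : IsCompact C := Set.Finite.isCompact_convexHull ℝ (u.finite_toSet.image _)
        have hCn : C.Nonempty := (hu.to_set.image _).convexHull
        obtain ⟨v, hv, hmin⟩ := exists_norm_eq_iInf_of_complete_convex hCn hCc.isComplete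
          (convex_convexHull ℝ _) 0
        have hle := (norm_eq_iInf_iff_real_inner_le_zero (convex_convexHull ℝ _) hv).1 hmin
        have hv0 : v ≠ 0 := fun h => h0 (h ▸ hCA hv)
        refine ⟨_, hunit v (hAV (hCA hv)) hv0, mem_iInter₂.2 fun a ha => ?_⟩
        have := hle a (subset_convexHull ℝ _ ⟨a, ha, rfl⟩)
        rw [zero_sub, inner_neg_left, inner_sub_right, real_inner_self_eq_norm_sq] at this
        change 0 ≤ ⟪‖v‖⁻¹ • v, a.1⟫
        rw [real_inner_smul_left]
        have h2 : 0 ≤ ⟪v, a.1⟫ := by nlinarith [sq_nonneg ‖v‖]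
        positivity
  exact ⟨p, hpV, by simpa using hp1, fun a ha => mem_iInter.1 hp ⟨a, ha⟩⟩

/-- A short step from `y` towards `a` stays in the neighbourhood, and there the functional is a
positive multiple of its value at `a`, since it vanishes at `y`. -/
theorem Convex.inner_nonneg_of_locally {X : Set E} (hX : Convex ℝ X) {p x y : E} (hy : y ∈ X)
    {ε : ℝ} (hε : 0 < ε) (hloc : ∀ y' ∈ X, dist y' y < ε → 0 ≤ ⟪p, y' - x⟫)
    (h0 : ⟪p, y - x⟫ = 0) {a : E} (ha : a ∈ X) : 0 ≤ ⟪p, a - x⟫ := by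
  have hpos : 0 < ‖a - y‖ + 1 := by positivity
  set s := min 1 (ε / (2 * (‖a - y‖ + 1))) with hs
  have hs0 : 0 < s := lt_min one_pos (by positivity)
  have hs1 : s ≤ 1 := min_le_left _ _
  have hsε : s * (‖a - y‖ + 1) ≤ ε / 2 := by
    calc s * (‖a - y‖ + 1) ≤ ε / (2 * (‖a - y‖ + 1)) * (‖a - y‖ + 1) := by
          gcongr; exact min_le_right _ _
      _ = ε / 2 := by field_simp
  have hmem : y + s • (a - y) ∈ X := hX.add_smul_sub_mem hy ha ⟨hs0.le, hs1⟩
  have h1 := hloc _ hmem (by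
    rw [dist_eq_norm, add_sub_cancel_left, norm_smul, Real.norm_of_nonneg hs0.le]
    nlinarith)
  have h2 : ⟪p, y + s • (a - y) - x⟫ = s * ⟪p, a - x⟫ := by
    have : y + s • (a - y) - x = (1 - s) • (y - x) + s • (a - x) := by module
    rw [this, inner_add_right, real_inner_smul_right, real_inner_smul_right, h0]
    ring
  rw [h2] at h1
  exact nonneg_of_mul_nonneg_right h1 hs0

theorem Convex.exists_add_smul_mem_of_mem_direction [FiniteDimensional ℝ E] {X : Set E}
    (hX : Convex ℝ X) (hne : X.Nonempty) :
    ∃ x ∈ X, ∃ r > 0, ∀ v ∈ (affineSpan ℝ X).direction, ‖v‖ ≤ r → x + v ∈ X := by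
  obtain ⟨x, hx⟩ := hne.intrinsicInterior hX
  obtain ⟨y, hy, rfl⟩ := mem_intrinsicInterior.1 hx
  obtain ⟨r, hr, hball⟩ := Metric.mem_nhds_iff.1 (mem_interior_iff_mem_nhds.1 hy)
  refine ⟨y, intrinsicInterior_subset hx, r / 2, half_pos hr, fun v hv hvr => ?_⟩
  have hmem : (y : E) + v ∈ affineSpan ℝ X := by
    rw [add_comm]
    exact AffineSubspace.vadd_mem_of_mem_direction hv y.2
  have : (⟨(y : E) + v, hmem⟩ : affineSpan ℝ X) ∈ Metric.ball y r := by
    rw [Metric.mem_ball, Subtype.dist_eq, dist_eq_norm]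
    simp only [add_sub_cancel_left]
    linarith
  exact hball this

end Support

/-! ### Openness of strict preference and geometry of the choice sets -/

namespace GNEP

section Relations

variable {E : Type*}

theorem ContinuousOver.eventually [TopologicalSpace E] {X : Set E} {pref : E → E → Prop}
    (h : ContinuousOver X pref) {u v : ℕ → E} {x y : E} (hu : ∀ k, u k ∈ X) (hv : ∀ k, v k ∈ X)
    (hx : x ∈ X) (hy : y ∈ X) (hux : Tendsto u atTop (𝓝 x)) (hvy : Tendsto v atTop (𝓝 y))
    (hxy : pref y x) : ∀ᶠ k in atTop, pref (v k) (u k) := by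
  by_contra hcon
  obtain ⟨φ, hφ, hφn⟩ := extraction_of_frequently_atTop (not_eventually.1 hcon)
  exact h (u ∘ φ) (v ∘ φ) x y (fun _ => hu _) (fun _ => hv _) hx hy
    (hux.comp hφ.tendsto_atTop) (hvy.comp hφ.tendsto_atTop) hφn hxy

end Relations

section Sets

variable {N : ℕ} {n : Fin N → ℕ} {S : Set (Profile n)}

theorem mem_profileSet_of_mem {z : Profile n} (hz : z ∈ S) : z ∈ profileSet (choiceSet S) :=
  fun _ => ⟨z, hz, rfl⟩

theorem convex_choiceSet (hS : Convex ℝ S) (i : Fin N) : Convex ℝ (choiceSet S i) :=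
  hS.linear_image (LinearMap.proj i : Profile n →ₗ[ℝ] _)

@[simp]
theorem replace_self (z : Profile n) (i : Fin N) : replace z i (z i) = z :=
  Function.update_eq_self i z

theorem replace_mem_profileSet {X : (i : Fin N) → Set (EuclideanSpace ℝ (Fin (n i)))}
    {z : Profile n} (hz : z ∈ profileSet X) {i : Fin N} {y : EuclideanSpace ℝ (Fin (n i))}
    (hy : y ∈ X i) : replace z i y ∈ profileSet X := by
  intro j
  by_cases h : j = i
  · subst h; simpa [replace] using hy
  · simpa [replace, h] using hz j

theorem replace_combo (z : Profile n) (i : Fin N) (y y' : EuclideanSpace ℝ (Fin (n i))) (t : ℝ) :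
    replace z i (t • y + (1 - t) • y') = t • replace z i y + (1 - t) • replace z i y' := by
  ext1 j
  by_cases h : j = i
  · subst h; simp [replace]
  · simp only [replace, Pi.add_apply, Pi.smul_apply, ne_eq, h, not_false_eq_true,
      Function.update_of_ne]
    module

theorem continuous_replace (i : Fin N) :
    Continuous fun a : Profile n × EuclideanSpace ℝ (Fin (n i)) => replace a.1 i a.2 :=
  continuous_fst.update i continuous_snd

/-- The point `x` of `S` is, uniformly in the player, a relative interior point of every
choice set. -/
theorem exists_common_interior_point (hS : Convex ℝ S) (hne : S.Nonempty) :
    ∃ x ∈ S, ∃ r > 0, ∀ i, ∀ v ∈ (affineSpan ℝ (choiceSet S i)).direction, ‖v‖ ≤ r →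
      x i + v ∈ choiceSet S i := by
  rcases Nat.eq_zero_or_pos N with rfl | hN
  · obtain ⟨x, hx⟩ := hne
    exact ⟨x, hx, 1, one_pos, fun i => i.elim0⟩
  have h := fun i => (convex_choiceSet hS i).exists_add_smul_mem_of_mem_direction (hne.image _)
  choose y hy ρ hρ hball using h
  choose s hsS hsy using hy
  obtain ⟨j₀, -, hmin⟩ := Finset.exists_min_image Finset.univ ρ ⟨⟨0, hN⟩, Finset.mem_univ _⟩
  have hN' : (0 : ℝ) < N := by exact_mod_cast hN
  have hsum : ∑ _j : Fin N, (N : ℝ)⁻¹ = 1 := by simp [hN'.ne']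
  refine ⟨∑ j, (N : ℝ)⁻¹ • s j, hS.sum_mem (fun _ _ => by positivity) hsum fun j _ => hsS j,
    ρ j₀ / N, div_pos (hρ j₀) hN', fun i v hv hvr => ?_⟩
  -- Here `s j ∈ S` is relatively interior in its `j`-th component. In the average, the whole
  -- displacement `v` is charged to the term `j = i`, which must absorb `N • v`; hence the radius `ρ
  -- j₀ / N`.
  have key : (∑ j, (N : ℝ)⁻¹ • s j) i + v =
      ∑ j, (N : ℝ)⁻¹ • (s j i + if j = i then (N : ℝ) • v else 0) := by
    simp only [smul_add, Finset.sum_add_distrib, Finset.sum_apply, Pi.smul_apply, smul_ite,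
      smul_zero, Finset.sum_ite_eq', Finset.mem_univ, if_true]
    rw [smul_smul, inv_mul_cancel₀ hN'.ne', one_smul]
  rw [key]
  refine (convex_choiceSet hS i).sum_mem (fun _ _ => by positivity) hsum fun j _ => ?_
  by_cases hj : j = i
  · subst hj
    rw [if_pos rfl, show s j j = y j from hsy j]
    refine hball j _ (Submodule.smul_mem _ _ hv) ?_
    rw [norm_smul, Real.norm_of_nonneg hN'.le]
    calc (N : ℝ) * ‖v‖ ≤ N * (ρ j₀ / N) := by gcongr
      _ = ρ j₀ := by field_simp
      _ ≤ ρ j := hmin j (Finset.mem_univ _)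
  · rw [if_neg hj, add_zero]
    exact ⟨s j, hsS j, rfl⟩

end Sets

end GNEP

theorem IsCompact.exists_combo_pos {α : Type*} [TopologicalSpace α] {K : Set α}
    (hK : IsCompact K) {f g : α → ℝ} (hf : Continuous f) (hg : Continuous g)
    (hf0 : ∀ p ∈ K, 0 ≤ f p) (hfg : ∀ p ∈ K, f p = 0 → 0 < g p) :
    ∃ t : ℝ, 0 < t ∧ t < 1 ∧ ∀ p ∈ K, 0 < (1 - t) * f p + t * g p := by
  suffices ∃ t : ℝ, 0 < t ∧ t < 1 ∧ ∀ p ∈ K, g p ≤ 0 → 0 < (1 - t) * f p + t * g p by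
    obtain ⟨t, ht0, ht1, ht⟩ := this
    refine ⟨t, ht0, ht1, fun p hp => ?_⟩
    rcases le_or_gt (g p) 0 with h | h
    · exact ht p hp h
    · have h1 := mul_pos ht0 h
      have h2 := mul_nonneg (sub_nonneg.2 ht1.le) (hf0 p hp)
      linarith
  have hA : IsCompact (K ∩ {p | g p ≤ 0}) := hK.inter_right (isClosed_le hg continuous_const)
  rcases (K ∩ {p | g p ≤ 0}).eq_empty_or_nonempty with he | hne
  · exact ⟨1 / 2, by norm_num, by norm_num, fun p hp h =>
      absurd (show p ∈ K ∩ {p | g p ≤ 0} from ⟨hp, h⟩) (by rw [he]; exact notMem_empty p)⟩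
  · obtain ⟨p₁, hp₁, hmin₁⟩ := hA.exists_isMinOn hne hf.continuousOn
    obtain ⟨p₂, hp₂, hmin₂⟩ := hA.exists_isMinOn hne hg.continuousOn
    have hα0 : 0 < f p₁ :=
      lt_of_le_of_ne (hf0 p₁ hp₁.1) fun h => (hfg p₁ hp₁.1 h.symm).not_ge hp₁.2
    have hγ : g p₂ ≤ 0 := hp₂.2
    have hden : 0 < 2 * (f p₁ - g p₂) := by linarith
    have ht1 : f p₁ / (2 * (f p₁ - g p₂)) < 1 := by rw [div_lt_one hden]; linarith
    have ht0 : 0 < f p₁ / (2 * (f p₁ - g p₂)) := div_pos hα0 hden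
    -- This `t` makes the combination of the two minimal values equal to `f p₁ / 2`.
    refine ⟨f p₁ / (2 * (f p₁ - g p₂)), ht0, ht1, fun p hp h => ?_⟩
    have h1 : f p₁ ≤ f p := isMinOn_iff.1 hmin₁ p ⟨hp, h⟩
    have h2 : g p₂ ≤ g p := isMinOn_iff.1 hmin₂ p ⟨hp, h⟩
    calc 0 < f p₁ / 2 := half_pos hα0
      _ = (1 - f p₁ / (2 * (f p₁ - g p₂))) * f p₁ + f p₁ / (2 * (f p₁ - g p₂)) * g p₂ := by
        have : f p₁ - g p₂ ≠ 0 := by linarith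
        field_simp
        ring
      _ ≤ _ := add_le_add (mul_le_mul_of_nonneg_left h1 (by linarith))
        (mul_le_mul_of_nonneg_left h2 ht0.le)

/-! ### Normals to preferred sets and the weighted pairing -/

namespace GNEP

open scoped RealInnerProductSpace

variable {N : ℕ} {n : Fin N → ℕ}

/-- The profiles of normals: `p i` is a unit vector parallel to the `i`-th choice set (or zero, if
that set is a point) which is normal at `z i` to the strategies that player `i` prefers to `z i`. -/
def normals (S : Set (Profile n)) (pref : Fin N → Profile n → Profile n → Prop) (z : Profile n) :
    Set (Profile n) :=
  {p | ∀ i, p i ∈ (affineSpan ℝ (choiceSet S i)).direction ∧ ‖p i‖ ≤ 1 ∧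
    (‖p i‖ = 1 ∨ (choiceSet S i).Subsingleton) ∧
    ∀ y ∈ choiceSet S i, pref i (replace z i y) z → 0 ≤ ⟪p i, y - z i⟫}

/-- The positive weight given to a normal whose product with the direction towards the
interior point is `τ`. -/
noncomputable def weight (δ r τ : ℝ) : ℝ := max δ (min 1 (τ / r))

/-- The weighted pairing of a profile `p` of normals at `z` with the direction from `z` to `w`. -/
noncomputable def pairing (δ r : ℝ) (x₀ z p w : Profile n) : ℝ :=
  ∑ i, weight δ r ⟪p i, x₀ i - z i⟫ * ⟪p i, w i - z i⟫

theorem continuous_weight (δ r : ℝ) : Continuous (weight δ r) := by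
  unfold weight; fun_prop

theorem weight_pos {δ : ℝ} (hδ : 0 < δ) (r τ : ℝ) : 0 < weight δ r τ :=
  lt_max_of_lt_left hδ

theorem neg_le_weight_mul {δ r D τ : ℝ} (hδ : 0 < δ) (hr : 0 < r) (hD : |τ| ≤ D) :
    -(δ * D) ≤ weight δ r τ * τ := by
  rcases le_or_gt τ 0 with h | h
  · have : weight δ r τ = δ :=
      max_eq_left ((min_le_right _ _).trans ((div_nonpos_of_nonpos_of_nonneg h hr.le).trans hδ.le))
    rw [this]
    nlinarith [neg_abs_le τ]
  · have h1 := mul_pos (weight_pos hδ r τ) h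
    have h2 : 0 ≤ D := (abs_nonneg τ).trans hD
    have h3 := mul_nonneg hδ.le h2
    linarith

theorem le_weight_mul {δ r τ : ℝ} (hr : 0 < r) (h : r ≤ τ) : r ≤ weight δ r τ * τ := by
  have h1 : 1 ≤ weight δ r τ := le_max_of_le_right (le_min le_rfl ((one_le_div hr).2 h))
  nlinarith

theorem continuous_pairing (δ r : ℝ) (x₀ w : Profile n) :
    Continuous fun a : Profile n × Profile n => pairing δ r x₀ a.1 a.2 w := by
  unfold pairing
  have := continuous_weight δ r
  fun_prop

theorem pairing_combo (δ r : ℝ) (x₀ z p w w' : Profile n) {a b : ℝ} (hab : a + b = 1) :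
    pairing δ r x₀ z p (a • w + b • w') =
      a * pairing δ r x₀ z p w + b * pairing δ r x₀ z p w' := by
  simp only [pairing, Finset.mul_sum, ← Finset.sum_add_distrib]
  refine Finset.sum_congr rfl fun i _ => ?_
  have : (a • w + b • w') i - z i = a • (w i - z i) + b • (w' i - z i) := by
    obtain rfl : b = 1 - a := by linarith
    simp only [Pi.add_apply, Pi.smul_apply]
    module
  rw [this, inner_add_right, real_inner_smul_right, real_inner_smul_right]
  ring

theorem pairing_self (δ r : ℝ) (x₀ z p : Profile n) : pairing δ r x₀ z p z = 0 := by
  simp [pairing]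

theorem pairing_replace (δ r : ℝ) (x₀ z p : Profile n) (i : Fin N)
    (y : EuclideanSpace ℝ (Fin (n i))) :
    pairing δ r x₀ z p (replace z i y) =
      weight δ r ⟪p i, x₀ i - z i⟫ * ⟪p i, y - z i⟫ := by
  unfold pairing
  rw [Finset.sum_eq_single i]
  · simp [replace]
  · intro j _ h
    simp [replace, h]
  · simp

variable {S : Set (Profile n)} {pref : Fin N → Profile n → Profile n → Prop}

/-- A strategy preferred at the limit is eventually preferred along the sequence, so its inequality
survives. The norm condition is closed because it is an equality unless the choice set is a point.
-/
theorem isCompact_graph_normals (hcomp : IsCompact S)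
    (hcont : ∀ i, ContinuousOver (profileSet (choiceSet S)) (pref i)) :
    IsCompact {a : Profile n × Profile n | a.1 ∈ S ∧ a.2 ∈ normals S pref a.1} := by
  refine (hcomp.prod (isCompact_closedBall (0 : Profile n) 1)).of_isClosed_subset ?_ ?_
  · refine IsSeqClosed.isClosed fun u a hu ha => ?_
    have h1 : Tendsto (fun k => (u k).1) atTop (𝓝 a.1) := (continuous_fst.tendsto a).comp ha
    have h2 : ∀ i, Tendsto (fun k => (u k).2 i) atTop (𝓝 (a.2 i)) := fun i =>
      (((continuous_apply i).comp continuous_snd).tendsto a).comp ha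
    have haS : a.1 ∈ S := hcomp.isClosed.mem_of_tendsto h1 (Eventually.of_forall fun k => (hu k).1)
    refine ⟨haS, fun i => ⟨?_, ?_, ?_, fun y hy hya => ?_⟩⟩
    · exact (Submodule.closed_of_finiteDimensional _).mem_of_tendsto (h2 i)
        (Eventually.of_forall fun k => ((hu k).2 i).1)
    · exact le_of_tendsto (h2 i).norm (Eventually.of_forall fun k => ((hu k).2 i).2.1)
    · by_cases hs : (choiceSet S i).Subsingleton
      · exact Or.inr hs
      · left
        have : ∀ k, ‖(u k).2 i‖ = 1 := fun k => ((hu k).2 i).2.2.1.resolve_right hs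
        exact tendsto_nhds_unique (h2 i).norm (by simp [this])
    · have hz : ∀ k, (u k).1 ∈ profileSet (choiceSet S) := fun k => mem_profileSet_of_mem (hu k).1
      have hev := (hcont i).eventually hz (fun k => replace_mem_profileSet (hz k) hy)
        (mem_profileSet_of_mem haS) (replace_mem_profileSet (mem_profileSet_of_mem haS) hy) h1
        (((continuous_replace i).tendsto (a.1, y)).comp (h1.prodMk_nhds tendsto_const_nhds)) hya
      refine ge_of_tendsto ((h2 i).inner (tendsto_const_nhds.sub
        (((continuous_apply i).tendsto _).comp h1))) ?_
      filter_upwards [hev] with k hk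
      exact ((hu k).2 i).2.2.2 y hy hk
  · rintro a ⟨h1, h2⟩
    refine ⟨h1, ?_⟩
    rw [mem_closedBall_zero_iff, pi_norm_le_iff_of_nonneg zero_le_one]
    exact fun i => (h2 i).2.1

theorem isCompact_normals (hcomp : IsCompact S)
    (hcont : ∀ i, ContinuousOver (profileSet (choiceSet S)) (pref i)) {z : Profile n}
    (hz : z ∈ S) : IsCompact (normals S pref z) := by
  have := ((isCompact_graph_normals hcomp hcont).inter_right
    (isClosed_singleton.preimage continuous_fst :
      IsClosed (Prod.fst ⁻¹' {z} : Set (Profile n × Profile n)))).image continuous_snd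
  convert this using 1
  ext p
  constructor
  · exact fun hp => ⟨(z, p), ⟨⟨hz, hp⟩, rfl⟩, rfl⟩
  · rintro ⟨a, ⟨⟨-, hp⟩, h⟩, rfl⟩
    have h : a.1 = z := h
    rwa [h] at hp

theorem convex_preferred (hconv : Convex ℝ S) {i : Fin N}
    (hpconv : ConvexOver (profileSet (choiceSet S)) (pref i)) {z : Profile n} (hz : z ∈ S) :
    Convex ℝ {y | y ∈ choiceSet S i ∧ pref i (replace z i y) z} := by
  have hzX := mem_profileSet_of_mem hz
  rintro y ⟨hy, hyz⟩ y' ⟨hy', hyz'⟩ a b ha hb hab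
  refine ⟨convex_choiceSet hconv i hy hy' ha hb hab, ?_⟩
  obtain rfl : b = 1 - a := by linarith
  rcases ha.eq_or_lt with rfl | ha
  · simpa using hyz'
  rcases hb.eq_or_lt with hb | hb
  · obtain rfl : a = 1 := by linarith
    simpa using hyz
  rw [replace_combo]
  exact hpconv _ (replace_mem_profileSet hzX hy) _ (replace_mem_profileSet hzX hy') _ hzX hyz hyz'
    a ha (by linarith)

theorem normals_nonempty (hconv : Convex ℝ S)
    (hirr : ∀ i, IrreflexiveOver (profileSet (choiceSet S)) (pref i))
    (hpconv : ∀ i, ConvexOver (profileSet (choiceSet S)) (pref i)) {z : Profile n} (hz : z ∈ S) :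
    (normals S pref z).Nonempty := by
  have hzX := mem_profileSet_of_mem hz
  have h : ∀ i, ∃ p : EuclideanSpace ℝ (Fin (n i)),
      p ∈ (affineSpan ℝ (choiceSet S i)).direction ∧ ‖p‖ ≤ 1 ∧
      (‖p‖ = 1 ∨ (choiceSet S i).Subsingleton) ∧
      ∀ y ∈ choiceSet S i, pref i (replace z i y) z → 0 ≤ ⟪p, y - z i⟫ := by
    intro i
    by_cases hs : (choiceSet S i).Subsingleton
    · exact ⟨0, Submodule.zero_mem _, by simp, Or.inr hs, by simp⟩
    have hsub : ∀ y ∈ choiceSet S i, ∀ y' ∈ choiceSet S i,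
        y - y' ∈ (affineSpan ℝ (choiceSet S i)).direction := fun y hy y' hy' =>
      AffineSubspace.vsub_mem_direction (mem_affineSpan ℝ hy) (mem_affineSpan ℝ hy')
    have hV : (affineSpan ℝ (choiceSet S i)).direction ≠ ⊥ := by
      obtain ⟨y, hy, y', hy', hne⟩ := not_subsingleton_iff.1 hs
      exact (Submodule.ne_bot_iff _).2 ⟨_, hsub y hy y' hy', sub_ne_zero.2 hne⟩
    obtain ⟨p, hpV, hp1, hp⟩ := Convex.exists_norm_eq_one_forall_inner_nonneg hV
      (A := {a | z i + a ∈ {y | y ∈ choiceSet S i ∧ pref i (replace z i y) z}})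
      ((convex_preferred hconv (hpconv i) hz).translate_preimage_right _)
      (fun a ha => by simpa using hsub _ ha.1 _ (hzX i))
      (fun h => hirr i z hzX (by simpa using h.2))
    exact ⟨p, hpV, hp1.le, Or.inl hp1, fun y hy hyz => hp _ (by simpa using ⟨hy, hyz⟩)⟩
  choose p hp using h
  exact ⟨p, hp⟩

/-- A normal that vanishes at some preferred strategy is an inner normal of the whole choice
set. -/
theorem inner_nonneg_of_mem_normals (hconv : Convex ℝ S) {i : Fin N}
    (hcont : ContinuousOver (profileSet (choiceSet S)) (pref i)) {z p : Profile n} (hz : z ∈ S)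
    (hp : p ∈ normals S pref z) {y : EuclideanSpace ℝ (Fin (n i))} (hy : y ∈ choiceSet S i)
    (hyz : pref i (replace z i y) z) (h0 : ⟪p i, y - z i⟫ = 0)
    {a : EuclideanSpace ℝ (Fin (n i))} (ha : a ∈ choiceSet S i) : 0 ≤ ⟪p i, a - z i⟫ := by
  have hzX := mem_profileSet_of_mem hz
  obtain ⟨ε, hε, hball⟩ : ∃ ε > 0, ∀ y' ∈ choiceSet S i, dist y' y < ε →
      pref i (replace z i y') z := by
    by_contra! hcon
    choose u hu hud hun using fun k : ℕ => hcon (1 / (k + 1)) Nat.one_div_pos_of_nat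
    have hlim : Tendsto u atTop (𝓝 y) := tendsto_iff_dist_tendsto_zero.2
      (squeeze_zero (fun _ => dist_nonneg) (fun k => (hud k).le)
        tendsto_one_div_add_atTop_nhds_zero_nat)
    obtain ⟨k, hk⟩ := (hcont.eventually (fun _ => hzX)
      (fun k => replace_mem_profileSet hzX (hu k)) hzX (replace_mem_profileSet hzX hy)
      tendsto_const_nhds
      (((continuous_replace i).tendsto (z, y)).comp (tendsto_const_nhds.prodMk_nhds hlim))
      hyz).exists
    exact hun k hk
  exact (convex_choiceSet hconv i).inner_nonneg_of_locally hy hε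
    (fun y' hy' hd => (hp i).2.2.2 y' hy' (hball y' hy' hd)) h0 ha

/-- If a normal of player `i` fails to separate strictly, then the weighted pairing with the
direction towards the interior point is positive. -/
theorem pairing_interior_pos (hconv : Convex ℝ S) {i : Fin N}
    (hirr : IrreflexiveOver (profileSet (choiceSet S)) (pref i))
    (hcont : ContinuousOver (profileSet (choiceSet S)) (pref i)) {x₀ z p : Profile n}
    {δ r D : ℝ} (hδ : 0 < δ) (hr : 0 < r) (hD0 : 0 ≤ D) (hδD : N * (δ * D) < r)
    (hD : dist x₀ z ≤ D)
    (hball : ∀ v ∈ (affineSpan ℝ (choiceSet S i)).direction, ‖v‖ ≤ r → x₀ i + v ∈ choiceSet S i)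
    (hz : z ∈ S) (hp : p ∈ normals S pref z) {y : EuclideanSpace ℝ (Fin (n i))}
    (hy : y ∈ choiceSet S i) (hyz : pref i (replace z i y) z) (h0 : ⟪p i, y - z i⟫ = 0) :
    0 < pairing δ r x₀ z p x₀ := by
  have hzX := mem_profileSet_of_mem hz
  have hp1 : ‖p i‖ = 1 := by
    refine (hp i).2.2.1.resolve_right fun hs => hirr z hzX ?_
    rwa [hs hy (hzX i), replace_self] at hyz
  -- The inner-normal inequality is tested at the point of `X_i` at distance `r` from `x₀ i` in
  -- direction `-p i`.
  have hri : r ≤ ⟪p i, x₀ i - z i⟫ := by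
    have hmem := hball (-(r • p i)) (Submodule.neg_mem _ (Submodule.smul_mem _ _ (hp i).1))
      (by rw [norm_neg, norm_smul, hp1, mul_one, Real.norm_of_nonneg hr.le])
    have := inner_nonneg_of_mem_normals hconv hcont hz hp hy hyz h0 hmem
    have h2 : x₀ i + -(r • p i) - z i = (x₀ i - z i) - r • p i := by abel
    rw [h2, inner_sub_right, real_inner_smul_right, real_inner_self_eq_norm_sq, hp1] at this
    linarith
  have habs : ∀ j, |⟪p j, x₀ j - z j⟫| ≤ D := by
    intro j
    have h1 : ‖x₀ j - z j‖ ≤ D := by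
      rw [← dist_eq_norm]; exact (dist_le_pi_dist x₀ z j).trans hD
    calc |⟪p j, x₀ j - z j⟫| ≤ ‖p j‖ * ‖x₀ j - z j‖ := abs_real_inner_le_norm _ _
      _ ≤ 1 * D := by gcongr; exact (hp j).2.1
      _ = D := one_mul D
  -- Shifting by `δ * D` makes every term nonnegative, so the `i`-th bounds the sum from below.
  have hsum : weight δ r ⟪p i, x₀ i - z i⟫ * ⟪p i, x₀ i - z i⟫ + δ * D ≤
      ∑ j, (weight δ r ⟪p j, x₀ j - z j⟫ * ⟪p j, x₀ j - z j⟫ + δ * D) :=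
    Finset.single_le_sum
      (f := fun j => weight δ r ⟪p j, x₀ j - z j⟫ * ⟪p j, x₀ j - z j⟫ + δ * D)
      (fun j _ => by linarith [neg_le_weight_mul hδ hr (habs j)]) (Finset.mem_univ i)
  rw [Finset.sum_add_distrib, Finset.sum_const, Finset.card_univ, Fintype.card_fin,
    nsmul_eq_mul] at hsum
  have := le_weight_mul (δ := δ) hr hri
  have hδD' := mul_nonneg hδ.le hD0
  unfold pairing
  linarith

theorem exists_pairing_pos (hconv : Convex ℝ S) (hcomp : IsCompact S) {i : Fin N}
    (hirr : IrreflexiveOver (profileSet (choiceSet S)) (pref i))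
    (hcont : ∀ i, ContinuousOver (profileSet (choiceSet S)) (pref i)) {x₀ z : Profile n}
    {δ r D : ℝ} (hδ : 0 < δ) (hr : 0 < r) (hD0 : 0 ≤ D) (hδD : N * (δ * D) < r)
    (hD : dist x₀ z ≤ D) (hx₀ : x₀ ∈ S)
    (hball : ∀ v ∈ (affineSpan ℝ (choiceSet S i)).direction, ‖v‖ ≤ r → x₀ i + v ∈ choiceSet S i)
    (hz : z ∈ S) {y : EuclideanSpace ℝ (Fin (n i))} (hy : y ∈ jointConstraint S i z)
    (hyz : pref i (replace z i y) z) :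
    ∃ w ∈ S, ∀ p ∈ normals S pref z, 0 < pairing δ r x₀ z p w := by
  have hcp : ∀ w, Continuous fun p => pairing δ r x₀ z p w := fun w => by
    have := continuous_weight δ r
    unfold pairing
    fun_prop
  obtain ⟨t, ht0, ht1, ht⟩ := (isCompact_normals hcomp hcont hz).exists_combo_pos
    (hcp (replace z i y)) (hcp x₀)
    (fun p hp => by
      rw [pairing_replace]
      exact mul_nonneg (weight_pos hδ _ _).le ((hp i).2.2.2 y hy.1 hyz))
    (fun p hp h => by
      rw [pairing_replace] at h
      have h0 : ⟪p i, y - z i⟫ = 0 := (mul_eq_zero.1 h).resolve_left (weight_pos hδ _ _).ne'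
      exact pairing_interior_pos hconv hirr (hcont i) hδ hr hD0 hδD hD hball hz hp hy.1 hyz h0)
  refine ⟨(1 - t) • replace z i y + t • x₀, hconv hy.2 hx₀ (by linarith) ht0.le (by ring),
    fun p hp => ?_⟩
  rw [pairing_combo _ _ _ _ _ _ _ (by ring)]
  exact ht p hp

end GNEP

/-! ### Existence of an equilibrium -/

theorem mainTheorem6 {N : ℕ} (n : Fin N → ℕ) (S : Set (GNEP.Profile n))
    (hconv : Convex ℝ S) (hcomp : IsCompact S) (hne : S.Nonempty)
    (pref : Fin N → GNEP.Profile n → GNEP.Profile n → Prop)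
    (hirr : ∀ i, GNEP.IrreflexiveOver (GNEP.profileSet (GNEP.choiceSet S)) (pref i))
    (hpconv : ∀ i, GNEP.ConvexOver (GNEP.profileSet (GNEP.choiceSet S)) (pref i))
    (hcont : ∀ i, GNEP.ContinuousOver (GNEP.profileSet (GNEP.choiceSet S)) (pref i)) :
    ∃ x : GNEP.Profile n,
      GNEP.IsEquilibrium (GNEP.choiceSet S) (GNEP.jointConstraint S) pref x := by
  by_contra hno
  obtain ⟨x₀, hx₀, r, hr, hball⟩ := GNEP.exists_common_interior_point hconv hne
  set D := Metric.diam S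
  have hD0 : 0 ≤ D := Metric.diam_nonneg
  obtain ⟨δ, hδ, hδD⟩ : ∃ δ > 0, (N : ℝ) * (δ * D) < r := by
    refine ⟨r / (N * D + 1), by positivity, ?_⟩
    rw [show (N : ℝ) * (r / (N * D + 1) * D) = r * (N * D) / (N * D + 1) by ring,
      div_lt_iff₀ (by positivity)]
    linarith
  obtain ⟨z, hz, hzT⟩ := exists_mem_self_of_isClosed_lower hconv hcomp hne
    (T := fun z => {w | ∀ p ∈ GNEP.normals S pref z, 0 < GNEP.pairing δ r x₀ z p w})
    (fun z _ w hw w' hw' a b ha hb hab p hp => by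
      rw [GNEP.pairing_combo _ _ _ _ _ _ _ hab]
      have h1 := hw p hp
      have h2 := hw' p hp
      rcases ha.eq_or_lt with rfl | ha
      · rw [zero_add] at hab
        simpa [hab] using h2
      · have h3 := mul_pos ha h1
        have h4 := mul_nonneg hb h2.le
        linarith)
    (fun z hz => by
      have hzX := GNEP.mem_profileSet_of_mem hz
      obtain ⟨i, y, hy, hyz⟩ : ∃ i, ∃ y ∈ GNEP.jointConstraint S i z,
          pref i (GNEP.replace z i y) z := by
        by_contra! hcon
        exact hno ⟨z, hzX, fun i => ⟨⟨hzX i, by simpa using hz⟩,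
          fun ⟨y, hy, hyz⟩ => hcon i y hy hyz⟩⟩
      exact GNEP.exists_pairing_pos hconv hcomp (hirr i) hcont hδ hr hD0 hδD
        (Metric.dist_le_diam_of_mem hcomp.isBounded hx₀ hz) hx₀ (hball i) hz hy hyz)
    -- The set where `w ∉ T z` is the projection of a closed part of the compact graph of normals.
    (fun w _ => by
      have := (((GNEP.isCompact_graph_normals hcomp hcont).inter_right
        (isClosed_le (GNEP.continuous_pairing δ r x₀ w) continuous_const :
          IsClosed {a : GNEP.Profile n × GNEP.Profile n |
            GNEP.pairing δ r x₀ a.1 a.2 w ≤ 0})).image continuous_fst).isClosed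
      convert this using 1
      ext z
      simp only [mem_ofPred_eq, not_forall, not_lt]
      constructor
      · rintro ⟨hz, p, hp, hle⟩
        exact ⟨(z, p), ⟨⟨hz, hp⟩, hle⟩, rfl⟩
      · rintro ⟨⟨z', p⟩, ⟨⟨hz, hp⟩, hle⟩, rfl⟩
        exact ⟨hz, p, hp, hle⟩)
  obtain ⟨p, hp⟩ := GNEP.normals_nonempty hconv hirr hpconv hz
  exact (hzT p hp).ne' (GNEP.pairing_self δ r x₀ z p)
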